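/- Let $\mathbb T=\mathbb R/\mathbb Z$, and for $t\in\mathbb T$ let $\|t\|$ be the distance from $t$ to the nearest integer. For $\tau\in\mathbb R$ let $DC(\tau)$ be the set of all $\alpha\in\mathbb T$ for which there is $c>0$ with $\|k\alpha\|\ge c\,|k|^{-\tau}$ for all $k\in\mathbb Z\setminus\{0\}$. For $d\ge 1$ and $\alpha\in\mathbb T$, the skew-shift $f=f_\alpha:\mathbb T^d\to\mathbb T^d$ is $$f(y_1,\dots,y_d)=(y_1+\alpha,\;y_2+y_1,\;\dots,\;y_d+y_{d-1}).$$ The discrepancy of finitely many points $x_1,\dots,x_N\in\mathbb T^d$ ($N\ge1$) is $$D(\{x_n\}_{n=1}^N)=\sup_{C}\left|\frac{\#\{1\le n\le N: x_n\in C\}}{N}-m(C)\right|,$$ where $m$ is normalized Lebesgue (Haar) measure and $C$ runs over all sets $\{\theta\in\mathbb T^d:\beta_i\le\theta_i<\kappa_i,\ 1\le i\le d\}$ with $0\le\beta_i<\kappa_i\le1$, the coordinates $\theta_i$ being represented in $[0,1)$. **Lemma.** Let $d\ge1$ be an integer and $\tau\in\mathbb R$. There is $\delta>0$, depending only on $d$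 and $\tau$, such that for every $\alpha\in DC(\tau)$ there is $N_0\in\mathbb N$ such that, for all integers $N>N_0$ and all $y\in\mathbb T^d$, $$D(\{f^n(y)\}_{n=1}^{N})\le N^{-\delta}.$$ Moreover, with the same $\delta$, $f$ has strongly $\delta$-bounded discrepancy: there is $N_0'\in\mathbb N$ such that $D(\{f^n(\theta)\}_{n=0}^{N-1})\le N^{-\delta}$ for all integers $N>N_0'$ and all $\theta\in\mathbb T^d$. -/

import Mathlib

open MeasureTheory

noncomputable section

/-- The one-frequency Diophantine class `DC(c, τ)`: all `α ∈ 𝕋 = ℝ/ℤ` with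
`‖k α‖ ≥ c / |k|^τ` for every nonzero integer `k`, where `‖·‖` is the distance to `ℤ`
(which is the norm of `UnitAddCircle`). -/
def DiophantineWith (c τ : ℝ) : Set UnitAddCircle :=
  {α | ∀ k : ℤ, k ≠ 0 → c / |(k : ℝ)| ^ τ ≤ ‖k • α‖}

/-- The Diophantine class `DC(τ) = ⋃_{c > 0} DC(c, τ)`. -/
def Diophantine (τ : ℝ) : Set UnitAddCircle :=
  {α | ∃ c : ℝ, 0 < c ∧ α ∈ DiophantineWith c τ}

/-- The skew-shift `(y₁, …, y_d) ↦ (y₁ + α, y₂ + y₁, …, y_d + y_{d-1})` of `𝕋^d`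
(coordinates are numbered from `0` to `d - 1`). -/
def skewShift (d : ℕ) (α : UnitAddCircle) (y : UnitAddTorus (Fin d)) : UnitAddTorus (Fin d) :=
  fun i => y i + if (i : ℕ) = 0 then α else y ⟨(i : ℕ) - 1, by omega⟩

/-- The representative in `[0, 1)` of a point of `𝕋 = ℝ/ℤ`. -/
def circleRep (t : UnitAddCircle) : ℝ := (AddCircle.equivIco (1 : ℝ) 0 t : ℝ)

/-- The subinterval `{θ ∈ 𝕋^d : β_i ≤ θ_i < κ_i for all i}`, coordinates being read in `[0, 1)`. -/
def torusBox {d : ℕ} (β κ : Fin d → ℝ) : Set (UnitAddTorus (Fin d)) :=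
  {θ | ∀ i, β i ≤ circleRep (θ i) ∧ circleRep (θ i) < κ i}

/-- The family of all subintervals of `𝕋^d`, with `0 ≤ β_i < κ_i ≤ 1`. -/
def torusIntervals (d : ℕ) : Set (Set (UnitAddTorus (Fin d))) :=
  {C | ∃ β κ : Fin d → ℝ, (∀ i, 0 ≤ β i ∧ β i < κ i ∧ κ i ≤ 1) ∧ C = torusBox β κ}

/-- The counting function `A(C; x)`: the number of indices `n` with `x_n ∈ C`. -/
def countIn {d N : ℕ} (C : Set (UnitAddTorus (Fin d))) (x : Fin N → UnitAddTorus (Fin d)) : ℝ :=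
  ∑ n : Fin N, C.indicator (fun _ => (1 : ℝ)) (x n)

/-- The discrepancy `sup_C |A(C; x) / N - m(C)|` of a finite sequence of points of `𝕋^d`, over all
subintervals `C`; `m` is the normalized Lebesgue measure. The set of values is nonempty and
bounded above by `1`, so that the real supremum is the true one. -/
def discrepancy {d N : ℕ} (x : Fin N → UnitAddTorus (Fin d)) : ℝ :=
  sSup {r : ℝ | ∃ C ∈ torusIntervals d, r = |countIn C x / (N : ℝ) - volume.real C|}

/-- `f` has strongly `δ`-bounded discrepancy: there is `N₀` with
`D({f^n θ}_{n=0}^{N-1}) ≤ N^{-δ}` for all `N > N₀` and all `θ ∈ 𝕋^d`. -/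
def HasStronglyBoundedDiscrepancy {d : ℕ} (δ : ℝ)
    (f : UnitAddTorus (Fin d) → UnitAddTorus (Fin d)) : Prop :=
  ∃ N₀ : ℕ, ∀ N : ℕ, N₀ < N → ∀ θ : UnitAddTorus (Fin d),
    discrepancy (fun n : Fin N => f^[(n : ℕ)] θ) ≤ (N : ℝ) ^ (-δ)

end

/-! Each forward difference in time turns a coordinate of an orbit into the preceding one, and the
first coordinate into the constant `α`. A nontrivial character along an orbit therefore has a
polynomial phase in `n`: if `r` is the last index (from `0`) with `k r ≠ 0`, its difference of order
`r + 1` is the constant `k r • α`. The starting point enters only the lower coefficients.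

Weyl differencing (`van_der_corput`) lowers the degree one step at a time and multiplies the top
difference by a nonzero integer of controlled size. In degree one a geometric sum remains, and the
Diophantine condition bounds it. This gives `weyl_sum_bound`, a power saving blind to the lower
coefficients, hence uniform in the starting point; its exponent does not depend on `α`, only its
constant does.

Fejér smoothing of boxes (`discrepancy_le`) converts these bounds into discrepancy. Everything is
measured by one parameter `M` with `M ^ A ≤ N`: frequencies up to `M ^ 3` are used and the
discrepancy is `O(1 / M)`. -/

/-! ### The character `t ↦ exp (2πit)` of the circle -/

/-- The standard character `t ↦ exp (2πit)` of `ℝ/ℤ`. -/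
noncomputable def unitExp (t : UnitAddCircle) : ℂ := (AddCircle.toCircle t : ℂ)

@[simp] lemma norm_unitExp (t : UnitAddCircle) : ‖unitExp t‖ = 1 := Circle.norm_coe _

@[simp] lemma unitExp_zero : unitExp 0 = 1 := by simp [unitExp]

lemma unitExp_add (s t : UnitAddCircle) : unitExp (s + t) = unitExp s * unitExp t := by
  simp [unitExp, AddCircle.toCircle_add]

lemma unitExp_sum {ι : Type*} (s : Finset ι) (f : ι → UnitAddCircle) :
    unitExp (∑ i ∈ s, f i) = ∏ i ∈ s, unitExp (f i) := by
  classical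
  induction s using Finset.induction_on with
  | empty => simp
  | insert a s ha ih => rw [Finset.sum_insert ha, Finset.prod_insert ha, unitExp_add, ih]

lemma unitExp_neg (t : UnitAddCircle) : unitExp (-t) = starRingEnd ℂ (unitExp t) := by
  simp [unitExp, AddCircle.toCircle_neg, ← Circle.coe_inv_eq_conj]

lemma unitExp_sub (s t : UnitAddCircle) :
    unitExp (s - t) = unitExp s * starRingEnd ℂ (unitExp t) := by
  rw [sub_eq_add_neg, unitExp_add, unitExp_neg]

lemma unitExp_nsmul (n : ℕ) (t : UnitAddCircle) : unitExp (n • t) = unitExp t ^ n := by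
  simp [unitExp, AddCircle.toCircle_nsmul]

lemma unitExp_coe (x : ℝ) :
    unitExp (x : UnitAddCircle) = Complex.exp (Complex.I * (2 * Real.pi * x : ℝ)) := by
  rw [unitExp, AddCircle.toCircle_apply_mk, Circle.coe_exp]
  congr 1
  push_cast
  ring

/-- The chord has length `2 |sin (π x)|`, and Jordan's inequality applies on `|x| ≤ 1/2`. -/
lemma four_mul_norm_le_norm_unitExp_sub_one (t : UnitAddCircle) :
    4 * ‖t‖ ≤ ‖unitExp t - 1‖ := by
  obtain ⟨x, rfl⟩ := QuotientAddGroup.mk_surjective t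
  change 4 * ‖(x : UnitAddCircle)‖ ≤ ‖unitExp (x : UnitAddCircle) - 1‖
  have hx : (x : UnitAddCircle) = ((x - round x : ℝ) : UnitAddCircle) := by
    rw [AddCircle.coe_sub]
    have : (((round x : ℤ) : ℝ) : UnitAddCircle) = 0 :=
      (AddCircle.coe_eq_zero_iff (1 : ℝ)).2 ⟨round x, by simp⟩
    rw [this, sub_zero]
  rw [UnitAddCircle.norm_eq, hx, unitExp_coe, Complex.norm_exp_I_mul_ofReal_sub_one]
  set y := x - round x with hy
  have hy2 : |y| ≤ 1 / 2 := abs_sub_round x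
  have h1 := Real.mul_abs_le_abs_sin (x := Real.pi * y) (by
    rw [abs_mul, abs_of_pos Real.pi_pos]; nlinarith [Real.pi_pos])
  rw [abs_mul, abs_of_pos Real.pi_pos] at h1
  have h2 : 2 / Real.pi * (Real.pi * |y|) = 2 * |y| := by
    field_simp
  rw [show 2 * Real.pi * y / 2 = Real.pi * y by ring, norm_mul, Real.norm_eq_abs, Real.norm_eq_abs,
    abs_two]
  linarith

lemma norm_geom_sum_unitExp_le (t : UnitAddCircle) (ht : t ≠ 0) (N : ℕ) :
    ‖∑ n ∈ Finset.range N, unitExp (n • t)‖ ≤ 1 / (2 * ‖t‖) := by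
  have ht0 : 0 < ‖t‖ := norm_pos_iff.2 ht
  have h4 := four_mul_norm_le_norm_unitExp_sub_one t
  have hne : unitExp t ≠ 1 := by
    intro h
    rw [h, sub_self, norm_zero] at h4
    linarith
  simp_rw [unitExp_nsmul]
  rw [geom_sum_eq hne, norm_div]
  have h2 : ‖unitExp t ^ N - 1‖ ≤ 2 := by
    refine (norm_sub_le _ _).trans ?_
    rw [norm_pow, norm_unitExp, one_pow, norm_one]
    norm_num
  calc _ ≤ 2 / (4 * ‖t‖) := by gcongr
    _ = _ := by field_simp; norm_num

/-! ### Van der Corput's inequality and Weyl sums -/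

/-- Each unit shift changes only the two boundary terms. -/
lemma norm_sum_range_shift_sub_le (u : ℕ → ℂ) (hu : ∀ n, ‖u n‖ ≤ 1) (N h : ℕ) :
    ‖∑ n ∈ Finset.range N, u (n + h) - ∑ n ∈ Finset.range N, u n‖ ≤ 2 * h := by
  induction h with
  | zero => simp
  | succ h ih =>
    have key : ∑ n ∈ Finset.range N, u (n + (h + 1)) - ∑ n ∈ Finset.range N, u (n + h)
        = u (N + h) - u h := by
      have := Finset.sum_range_sub (fun n => u (n + h)) N
      rw [← Finset.sum_sub_distrib]
      simpa [add_right_comm, add_assoc, add_comm, add_left_comm] using this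
    have : ∑ n ∈ Finset.range N, u (n + (h + 1)) - ∑ n ∈ Finset.range N, u n
        = (u (N + h) - u h) + (∑ n ∈ Finset.range N, u (n + h) - ∑ n ∈ Finset.range N, u n) := by
      rw [← key]; ring
    rw [this]
    refine (norm_add_le _ _).trans ?_
    have := norm_sub_le (u (N + h)) (u h)
    have := hu (N + h)
    have := hu h
    push_cast
    linarith

/-- Averaging over `H` shifts costs at most `2 * H`. Cauchy–Schwarz then leads to `H ^ 2`
correlations: the `H` diagonal ones are bounded trivially by `N`, the others by `hcorr`. -/
lemma van_der_corput (u : ℕ → ℂ) (hu : ∀ n, ‖u n‖ ≤ 1) (N H : ℕ) (hH : 0 < H) (B : ℝ)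
    (hB : 0 ≤ B)
    (hcorr : ∀ i < H, ∀ j < H, i ≠ j →
      ‖∑ n ∈ Finset.range N, u (n + i) * starRingEnd ℂ (u (n + j))‖ ≤ N * B) :
    ‖∑ n ∈ Finset.range N, u n‖ ≤ 2 * H + N * √(1 / H + B) := by
  set S := ∑ n ∈ Finset.range N, u n with hS
  set V : ℕ → ℂ := fun n => ∑ i ∈ Finset.range H, u (n + i) with hV
  have hHr : (0 : ℝ) < H := by exact_mod_cast hH
  have h1 : ‖∑ n ∈ Finset.range N, V n - H * S‖ ≤ H * (2 * H) := by
    have : ∑ n ∈ Finset.range N, V n - H * S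
        = ∑ i ∈ Finset.range H, (∑ n ∈ Finset.range N, u (n + i) - S) := by
      rw [Finset.sum_sub_distrib, Finset.sum_comm]
      simp
    rw [this]
    refine (norm_sum_le_of_le (f := fun i => ∑ n ∈ Finset.range N, u (n + i) - S)
      (n := fun _ => 2 * (H : ℝ)) _ ?_).trans ?_
    · intro i hi
      refine (norm_sum_range_shift_sub_le u hu N i).trans ?_
      have : (i : ℝ) ≤ H := by exact_mod_cast (Finset.mem_range.1 hi).le
      linarith
    · simp
  have h2 : ∑ n ∈ Finset.range N, ‖V n‖ ^ 2 ≤ N * (H + H ^ 2 * B) := by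
    have e : ((∑ n ∈ Finset.range N, ‖V n‖ ^ 2 : ℝ) : ℂ)
        = ∑ i ∈ Finset.range H, ∑ j ∈ Finset.range H,
          ∑ n ∈ Finset.range N, u (n + i) * starRingEnd ℂ (u (n + j)) := by
      push_cast
      calc _ = ∑ n ∈ Finset.range N, ∑ i ∈ Finset.range H, ∑ j ∈ Finset.range H,
            u (n + i) * starRingEnd ℂ (u (n + j)) := by
            refine Finset.sum_congr rfl fun n _ => ?_
            rw [← Complex.mul_conj', hV, map_sum, Finset.sum_mul_sum]
        _ = _ := by
            rw [Finset.sum_comm]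
            exact Finset.sum_congr rfl fun i _ => Finset.sum_comm
    have e2 : ∑ n ∈ Finset.range N, ‖V n‖ ^ 2
        = ‖((∑ n ∈ Finset.range N, ‖V n‖ ^ 2 : ℝ) : ℂ)‖ := by
      rw [Complex.norm_real, Real.norm_of_nonneg]
      positivity
    rw [e2, e]
    have hterm : ∀ i ∈ Finset.range H, ∀ j ∈ Finset.range H,
        ‖∑ n ∈ Finset.range N, u (n + i) * starRingEnd ℂ (u (n + j))‖
          ≤ (if i = j then (N : ℝ) else 0) + N * B := by
      intro i hi j hj
      split_ifs with hij
      · have : ‖∑ n ∈ Finset.range N, u (n + i) * starRingEnd ℂ (u (n + j))‖ ≤ N := by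
          refine (norm_sum_le_of_le (n := fun _ => (1 : ℝ)) _ ?_).trans (by simp)
          intro n _
          rw [norm_mul, RCLike.norm_conj]
          exact mul_le_one₀ (hu _) (norm_nonneg _) (hu _)
        have : (0 : ℝ) ≤ N * B := by positivity
        linarith
      · rw [zero_add]
        exact hcorr i (Finset.mem_range.1 hi) j (Finset.mem_range.1 hj) hij
    refine (norm_sum_le_of_le _ fun i hi => norm_sum_le_of_le _ fun j hj => hterm i hi j hj).trans ?_
    apply le_of_eq
    simp only [Finset.sum_add_distrib, Finset.sum_ite_eq, Finset.sum_const, Finset.card_range,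
      nsmul_eq_mul]
    rw [Finset.sum_congr rfl (g := fun _ => (N : ℝ)) (fun i hi => if_pos hi)]
    simp
    ring
  have h3 : ‖∑ n ∈ Finset.range N, V n‖ ≤ N * H * √(1 / H + B) := by
    have hcs : (∑ n ∈ Finset.range N, ‖V n‖) ^ 2 ≤ N * ∑ n ∈ Finset.range N, ‖V n‖ ^ 2 := by
      simpa using sq_sum_le_card_mul_sum_sq (s := Finset.range N) (f := fun n => ‖V n‖)
    refine (norm_sum_le _ _).trans ?_
    refine le_of_sq_le_sq ?_ (by positivity)
    calc _ ≤ (N : ℝ) * (N * (H + H ^ 2 * B)) := hcs.trans (by gcongr)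
      _ = (N * H * √(1 / H + B)) ^ 2 := by
        rw [mul_pow, Real.sq_sqrt (by positivity)]
        field_simp
  have h4 : H * ‖S‖ ≤ H * (2 * H + N * √(1 / H + B)) := by
    have : (H : ℂ) * S = ∑ n ∈ Finset.range N, V n - (∑ n ∈ Finset.range N, V n - H * S) := by ring
    have h5 : ‖(H : ℂ) * S‖ = H * ‖S‖ := by simp
    rw [← h5, this]
    refine (norm_sub_le _ _).trans ?_
    linarith
  exact le_of_mul_le_mul_left h4 hHr

/-- By telescoping, the increment over `h` is a sum of `h` translates of the first difference, each
contributing `β`. -/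
lemma fwdDiff_iter_shift_sub {G : Type*} [AddCommGroup G] (D : ℕ) (φ : ℕ → G) (β : G)
    (hφ : (fwdDiff 1)^[D + 1] φ = fun _ => β) (h : ℕ) :
    (fwdDiff 1)^[D] (fun n => φ (n + h) - φ n) = fun _ => h • β := by
  have e : (fun n => φ (n + h) - φ n)
      = ∑ j ∈ Finset.range h, (fun n => (fwdDiff 1 φ) (n + j)) := by
    ext n
    have := Finset.sum_range_sub (fun j => φ (n + j)) h
    simpa [fwdDiff, add_assoc] using this.symm
  rw [e, fwdDiff_iter_finsetSum]
  ext n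
  rw [Finset.sum_apply]
  simp_rw [fwdDiff_iter_comp_add, ← Function.iterate_succ_apply, hφ]
  simp

lemma fwdDiff_iter_shift_sub_shift {G : Type*} [AddCommGroup G] (D : ℕ) (φ : ℕ → G) (β : G)
    (hφ : (fwdDiff 1)^[D + 1] φ = fun _ => β) (i j : ℕ) :
    (fwdDiff 1)^[D] (fun n => φ (n + i) - φ (n + j)) = fun _ => ((i : ℤ) - j) • β := by
  have e : (fun n => φ (n + i) - φ (n + j))
      = (fun n => φ (n + i) - φ n) + (-1 : ℤ) • (fun n => φ (n + j) - φ n) := by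
    ext n
    simp
  rw [e, fwdDiff_iter_add, fwdDiff_iter_const_smul, fwdDiff_iter_shift_sub D φ β hφ,
    fwdDiff_iter_shift_sub D φ β hφ]
  ext n
  simp only [Pi.add_apply, Pi.neg_apply, sub_smul, natCast_zsmul, neg_smul, one_smul]
  abel

lemma pow_mul_le_of_le {M N A : ℕ} {a b : ℕ} (hM : 1 ≤ M) (hN : M ^ A ≤ N) (h : a + b ≤ A) :
    (M : ℝ) ^ a * M ^ b ≤ N := by
  rw [← pow_add]
  have h1 : M ^ (a + b) ≤ N := (Nat.pow_le_pow_right hM h).trans hN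
  exact_mod_cast h1

/-- **Weyl's inequality** for polynomial phases with Diophantine leading coefficient, with a power
saving that is uniform in the lower order coefficients. -/
theorem weyl_sum_bound (T D s v : ℕ) : ∃ A : ℕ, ∀ (α : UnitAddCircle) (c : ℝ), 0 < c →
    α ∈ DiophantineWith c T → ∃ C : ℝ, 0 ≤ C ∧ ∀ M N : ℕ, 1 ≤ M → M ^ A ≤ N →
      ∀ (q : ℤ) (φ : ℕ → UnitAddCircle), q ≠ 0 → |(q : ℝ)| ≤ M ^ v →
        (fwdDiff 1)^[D + 1] φ = (fun _ => q • α) →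
        ‖∑ n ∈ Finset.range N, unitExp (φ n)‖ ≤ N * (C / M ^ s) := by
  induction D generalizing s v with
  | zero =>
    -- The geometric sum is at most `M ^ (v * T) / (2 * c)`; the extra `s` in the exponent is the
    -- saving.
    refine ⟨v * T + s, fun α c hc hα => ⟨1 / (2 * c), by positivity, ?_⟩⟩
    intro M N hM hN q φ hq hqM hφ
    have hMr : (1 : ℝ) ≤ M := by exact_mod_cast hM
    have hstep : ∀ n, φ n = n • (q • α) + φ 0 := by
      intro n
      have := fwdDiff_iter_shift_sub 0 φ _ hφ n
      have := congrFun this 0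
      simp only [Function.iterate_zero, id_eq, zero_add] at this
      rw [← this]; abel
    have hq1 : (0 : ℝ) < |(q : ℝ)| := abs_pos.2 (by exact_mod_cast hq)
    have hlow : c / |(q : ℝ)| ^ T ≤ ‖q • α‖ := by
      have := hα q hq
      rwa [Real.rpow_natCast] at this
    have hlow2 : c / (M : ℝ) ^ (v * T) ≤ ‖q • α‖ := by
      refine le_trans ?_ hlow
      rw [pow_mul]
      gcongr
    have hpos : 0 < ‖q • α‖ := lt_of_lt_of_le (by positivity) hlow2
    have e : ∑ n ∈ Finset.range N, unitExp (φ n)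
        = (∑ n ∈ Finset.range N, unitExp (n • (q • α))) * unitExp (φ 0) := by
      rw [Finset.sum_mul]
      exact Finset.sum_congr rfl fun n _ => by rw [← unitExp_add, ← hstep]
    rw [e, norm_mul, norm_unitExp, mul_one]
    refine (norm_geom_sum_unitExp_le _ (norm_pos_iff.1 hpos) N).trans ?_
    have hN2 := pow_mul_le_of_le (a := v * T) (b := s) hM hN le_rfl
    calc 1 / (2 * ‖q • α‖) ≤ 1 / (2 * (c / (M : ℝ) ^ (v * T))) := by gcongr
      _ = ((M : ℝ) ^ (v * T) * M ^ s) * (1 / (2 * c) / M ^ s) := by field_simp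
      _ ≤ _ := by gcongr
  | succ D ih =>
    -- With `H = M ^ (2 * s)`, differencing enlarges `q` by a factor up to `H`, and the square root
    -- halves the saving. The extra `3 * s` in the exponent makes the term `2 * H` at most `N * (2 /
    -- M ^ s)`.
    obtain ⟨A, hA⟩ := ih (2 * s) (v + 2 * s)
    refine ⟨A + 3 * s, fun α c hc hα => ?_⟩
    obtain ⟨C, hC, hbound⟩ := hA α c hc hα
    refine ⟨2 + √(1 + C), by positivity, ?_⟩
    intro M N hM hN q φ hq hqM hφ
    have hMr : (1 : ℝ) ≤ M := by exact_mod_cast hM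
    have hN1 : M ^ A ≤ N := (Nat.pow_le_pow_right hM (by omega)).trans hN
    have hN2 := pow_mul_le_of_le (a := 2 * s) (b := s) hM hN (by omega)
    have hvdc := van_der_corput (fun n => unitExp (φ n)) (fun n => (norm_unitExp _).le) N
      (M ^ (2 * s)) (by positivity) (C / M ^ (2 * s)) (by positivity) ?_
    · refine hvdc.trans ?_
      have e1 : √(1 / ((M ^ (2 * s) : ℕ) : ℝ) + C / M ^ (2 * s)) = √(1 + C) / M ^ s := by
        rw [show 1 / ((M ^ (2 * s) : ℕ) : ℝ) + C / M ^ (2 * s) = (1 + C) / ((M : ℝ) ^ s) ^ 2 by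
          push_cast; rw [← pow_mul, mul_comm s 2]; ring, Real.sqrt_div (by positivity),
          Real.sqrt_sq (by positivity)]
      rw [e1]
      have e2 : 2 * ((M ^ (2 * s) : ℕ) : ℝ) ≤ N * (2 / M ^ s) := by
        push_cast
        calc 2 * (M : ℝ) ^ (2 * s) = ((M : ℝ) ^ (2 * s) * M ^ s) * (2 / M ^ s) := by field_simp
          _ ≤ _ := by gcongr
      rw [add_div, mul_add]
      linarith
    · intro i hi j hj hij
      simp_rw [← unitExp_sub]
      refine hbound M N hM hN1 (((i : ℤ) - j) * q) _ ?_ ?_ ?_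
      · exact mul_ne_zero (sub_ne_zero.2 (by exact_mod_cast hij)) hq
      · have hij2 : |((i : ℝ) - j)| ≤ (M : ℝ) ^ (2 * s) := by
          have hi' : (i : ℝ) < (M : ℝ) ^ (2 * s) := by exact_mod_cast hi
          have hj' : (j : ℝ) < (M : ℝ) ^ (2 * s) := by exact_mod_cast hj
          have : (0 : ℝ) ≤ i := by positivity
          have : (0 : ℝ) ≤ j := by positivity
          rw [abs_le]; constructor <;> linarith
        push_cast
        rw [abs_mul, pow_add, mul_comm]
        gcongr
      · rw [fwdDiff_iter_shift_sub_shift (D + 1) φ _ hφ i j]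
        ext n
        rw [mul_smul]

/-! ### The Fejér kernel and smoothed indicator functions of intervals -/

lemma continuous_unitExp : Continuous unitExp :=
  continuous_subtype_val.comp AddCircle.continuous_toCircle

/-- The Fejér kernel `|∑_{j < K} e(jt)|² / K`. -/
noncomputable def fejer (K : ℕ) (t : UnitAddCircle) : ℝ :=
  ‖∑ j ∈ Finset.range K, unitExp (j • t)‖ ^ 2 / K

lemma fejer_nonneg (K : ℕ) (t : UnitAddCircle) : 0 ≤ fejer K t := by
  unfold fejer; positivity

lemma continuous_fejer (K : ℕ) : Continuous (fejer K) := by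
  unfold fejer
  have := continuous_unitExp
  fun_prop

lemma fejer_le (K : ℕ) (t : UnitAddCircle) (ε : ℝ) (hε : 0 < ε) (ht : ε ≤ ‖t‖) :
    fejer K t ≤ 1 / (4 * K * ε ^ 2) := by
  have ht0 : 0 < ‖t‖ := hε.trans_le ht
  have h1 : ‖∑ j ∈ Finset.range K, unitExp (j • t)‖ ≤ 1 / (2 * ε) :=
    (norm_geom_sum_unitExp_le t (norm_pos_iff.1 ht0) K).trans (by gcongr)
  calc fejer K t ≤ (1 / (2 * ε)) ^ 2 / K := by unfold fejer; gcongr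
    _ = _ := by
      rw [div_pow, div_div, mul_pow, one_pow]
      ring_nf

/-- The sum stays indexed by pairs rather than by frequency, so every coefficient is `1 / K` and no
multiplicities need counting. -/
lemma fejer_eq_sum (K : ℕ) (t : UnitAddCircle) :
    (fejer K t : ℂ) = ∑ p ∈ Finset.range K ×ˢ Finset.range K,
      (1 / K : ℂ) * unitExp (((p.1 : ℤ) - p.2) • t) := by
  unfold fejer
  push_cast
  rw [← Complex.mul_conj', map_sum, Finset.sum_mul_sum, ← Finset.sum_product', ← Finset.mul_sum,
    div_eq_inv_mul, one_div]
  congr 1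
  refine Finset.sum_congr rfl fun p _ => ?_
  rw [sub_smul, unitExp_sub, natCast_zsmul, natCast_zsmul]

/-- The convolution of the Fejér kernel with the indicator function of the interval `[a, b]`. -/
noncomputable def fejerSmooth (K : ℕ) (a b : ℝ) (t : UnitAddCircle) : ℝ :=
  ∫ s in a..b, fejer K (t - (s : UnitAddCircle))

/-- The Fourier coefficients of `fejerSmooth`. -/
noncomputable def fejerCoeff (K : ℕ) (a b : ℝ) (p : ℕ × ℕ) : ℂ :=
  (1 / K : ℂ) * ∫ s in a..b, unitExp (-(((p.1 : ℤ) - p.2) • (s : UnitAddCircle)))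

lemma continuous_fejer_sub (K : ℕ) (t : UnitAddCircle) :
    Continuous fun s : ℝ => fejer K (t - (s : UnitAddCircle)) :=
  (continuous_fejer K).comp (continuous_const.sub (AddCircle.continuous_mk' 1))

lemma continuous_unitExp_neg_zsmul (k : ℤ) :
    Continuous fun s : ℝ => unitExp (-(k • (s : UnitAddCircle))) :=
  continuous_unitExp.comp (((AddCircle.continuous_mk' 1).zsmul k).neg)

lemma fejerSmooth_eq_sum (K : ℕ) (a b : ℝ) (t : UnitAddCircle) :
    (fejerSmooth K a b t : ℂ) = ∑ p ∈ Finset.range K ×ˢ Finset.range K,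
      fejerCoeff K a b p * unitExp (((p.1 : ℤ) - p.2) • t) := by
  unfold fejerSmooth fejerCoeff
  rw [← intervalIntegral.integral_ofReal]
  simp_rw [fejer_eq_sum, smul_sub, sub_eq_add_neg, unitExp_add]
  rw [intervalIntegral.integral_finsetSum]
  · refine Finset.sum_congr rfl fun p _ => ?_
    simp_rw [← mul_assoc]
    rw [intervalIntegral.integral_const_mul]
    ring
  · intro p _
    refine Continuous.intervalIntegrable ?_ _ _
    exact continuous_const.mul (continuous_const.mul (continuous_unitExp_neg_zsmul _))

lemma integral_unitExp_neg_zsmul (k : ℤ) (hk : k ≠ 0) (a : ℝ) :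
    ∫ s in a..(a + 1), unitExp (-(k • (s : UnitAddCircle))) = 0 := by
  set w : ℂ := -(2 * Real.pi * k * Complex.I) with hw
  have hw0 : w ≠ 0 := by
    simp [hw, Real.pi_ne_zero, hk]
  have e : ∀ s : ℝ, unitExp (-(k • (s : UnitAddCircle))) = Complex.exp (w * s) := by
    intro s
    rw [← AddCircle.coe_zsmul, ← AddCircle.coe_neg, unitExp_coe]
    congr 1
    rw [hw]; push_cast [zsmul_eq_mul]; ring
  have hper : Complex.exp (w * ((a + 1 : ℝ) : ℂ)) = Complex.exp (w * a) := by
    rw [← e, ← e, AddCircle.coe_add_period]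
  simp_rw [e]
  rw [integral_exp_mul_complex hw0, hper, sub_self, zero_div]

lemma fejerCoeff_diag (K : ℕ) (a b : ℝ) (p : ℕ × ℕ) (hp : p.1 = p.2) :
    fejerCoeff K a b p = ((b - a) / K : ℝ) := by
  simp [fejerCoeff, hp, div_eq_inv_mul]

lemma norm_fejerCoeff_le (K : ℕ) (a b : ℝ) (hab : a ≤ b) (p : ℕ × ℕ) :
    ‖fejerCoeff K a b p‖ ≤ (b - a) / K := by
  have h := intervalIntegral.norm_integral_le_of_norm_le_const (a := a) (b := b) (C := 1)
    (f := fun s : ℝ => unitExp (-(((p.1 : ℤ) - p.2) • (s : UnitAddCircle))))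
    (fun s _ => (norm_unitExp _).le)
  rw [abs_of_nonneg (sub_nonneg.2 hab), one_mul] at h
  have hK : ‖(1 / K : ℂ)‖ = (K : ℝ)⁻¹ := by simp
  rw [fejerCoeff, norm_mul, hK, div_eq_inv_mul]
  gcongr

lemma sum_diag_const (K : ℕ) (hK : 0 < K) (x : ℝ) :
    ∑ p ∈ Finset.range K ×ˢ Finset.range K, (if p.1 = p.2 then x / K else 0) = x := by
  have : (K : ℝ) ≠ 0 := by positivity
  rw [Finset.sum_product]
  simp only [Finset.sum_ite_eq, Finset.sum_ite_mem, Finset.inter_self, Finset.sum_const,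
    Finset.card_range, nsmul_eq_mul]
  field_simp

/-- Over a full period only the `K` diagonal pairs survive, each contributing `1 / K`. -/
lemma fejerSmooth_period (K : ℕ) (hK : 0 < K) (a : ℝ) (t : UnitAddCircle) :
    fejerSmooth K a (a + 1) t = 1 := by
  have h := fejerSmooth_eq_sum K a (a + 1) t
  have h2 : ∀ p ∈ Finset.range K ×ˢ Finset.range K,
      fejerCoeff K a (a + 1) p * unitExp (((p.1 : ℤ) - p.2) • t)
        = (((if p.1 = p.2 then (1 : ℝ) / K else 0) : ℝ) : ℂ) := by
    intro p _
    split_ifs with hp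
    · rw [fejerCoeff_diag _ _ _ _ hp, hp]
      simp
    · rw [fejerCoeff, integral_unitExp_neg_zsmul _ (sub_ne_zero.2 (by exact_mod_cast hp))]
      simp
  rw [Finset.sum_congr rfl h2, ← Complex.ofReal_sum, sum_diag_const K hK] at h
  exact_mod_cast h

lemma fejerSmooth_nonneg (K : ℕ) (a b : ℝ) (hab : a ≤ b) (t : UnitAddCircle) :
    0 ≤ fejerSmooth K a b t :=
  intervalIntegral.integral_nonneg hab fun _ _ => fejer_nonneg _ _

lemma fejerSmooth_mono (K : ℕ) {a b a' b' : ℝ} (ha : a' ≤ a) (hab : a ≤ b) (hb : b ≤ b')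
    (t : UnitAddCircle) : fejerSmooth K a b t ≤ fejerSmooth K a' b' t :=
  intervalIntegral.integral_mono_interval ha hab hb
    (Filter.Eventually.of_forall fun _ => fejer_nonneg _ _)
    ((continuous_fejer_sub K t).intervalIntegrable _ _)

lemma fejerSmooth_le_one (K : ℕ) (hK : 0 < K) (a b : ℝ) (hab : a ≤ b) (hb : b ≤ a + 1)
    (t : UnitAddCircle) : fejerSmooth K a b t ≤ 1 :=
  (fejerSmooth_mono K le_rfl hab hb t).trans (fejerSmooth_period K hK a t).le

lemma le_norm_coe_of_abs_mem (x ε : ℝ) (h1 : ε ≤ |x|) (h2 : |x| ≤ 1 - ε) :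
    ε ≤ ‖(x : UnitAddCircle)‖ := by
  rw [UnitAddCircle.norm_eq]
  rcases eq_or_ne (round x) 0 with h | h
  · simpa [h] using h1
  · have h3 : (1 : ℝ) ≤ |(round x : ℝ)| := by exact_mod_cast Int.one_le_abs h
    have h4 := abs_sub_abs_le_abs_sub (round x : ℝ) x
    rw [abs_sub_comm] at h4
    linarith

lemma fejerSmooth_le_of_far (K : ℕ) (a b r ε : ℝ) (hε : 0 < ε) (hab : a ≤ b) (hb : b ≤ a + 1)
    (hfar : ∀ s ∈ Set.Icc a b, ε ≤ |r - s| ∧ |r - s| ≤ 1 - ε) :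
    fejerSmooth K a b (r : UnitAddCircle) ≤ 1 / (4 * K * ε ^ 2) := by
  have h : fejerSmooth K a b (r : UnitAddCircle) ≤ ∫ _ in a..b, 1 / (4 * (K : ℝ) * ε ^ 2) := by
    refine intervalIntegral.integral_mono_on hab ((continuous_fejer_sub K _).intervalIntegrable _ _)
      (by simp) fun s hs => fejer_le K _ ε hε ?_
    rw [← AddCircle.coe_sub]
    exact le_norm_coe_of_abs_mem _ _ (hfar s hs).1 (hfar s hs).2
  refine h.trans ?_
  rw [intervalIntegral.integral_const, smul_eq_mul]
  exact mul_le_of_le_one_left (by positivity) (by linarith)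

/-- The total mass over a period is `1`, and the arc from `r + ε` to `r - ε + 1` stays at distance
at least `ε` from `r`, so it carries little of it. -/
lemma one_sub_le_fejerSmooth (K : ℕ) (hK : 0 < K) (a b r ε : ℝ) (hε : 0 < ε) (hε2 : ε ≤ 1 / 2)
    (ha : a ≤ r - ε) (hb : r + ε ≤ b) :
    1 - 1 / (4 * K * ε ^ 2) ≤ fejerSmooth K a b (r : UnitAddCircle) := by
  refine le_trans ?_ (fejerSmooth_mono K ha (by linarith) hb _)
  have hfar := fejerSmooth_le_of_far K (r + ε) (r - ε + 1) r ε hε (by linarith) (by linarith) (by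
    intro s hs
    rw [abs_sub_comm, abs_of_nonneg (by linarith [hs.1])]
    constructor <;> linarith [hs.1, hs.2])
  have hadd : fejerSmooth K (r - ε) (r + ε) (r : UnitAddCircle)
      + fejerSmooth K (r + ε) (r - ε + 1) (r : UnitAddCircle)
      = fejerSmooth K (r - ε) (r - ε + 1) (r : UnitAddCircle) :=
    intervalIntegral.integral_add_adjacent_intervals
      ((continuous_fejer_sub K _).intervalIntegrable _ _)
      ((continuous_fejer_sub K _).intervalIntegrable _ _)
  rw [fejerSmooth_period K hK] at hadd
  linarith

/-! ### From exponential sums to discrepancy -/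

/-- The mean of a product of trigonometric polynomials along a finite sequence of points differs
little from the product of their constant terms, if all nontrivial exponential sums are small. -/
lemma abs_sum_prod_sub_le {d : ℕ} {ι : Type*} (x : ℕ → UnitAddTorus (Fin d)) (N : ℕ)
    (S : Finset ι) (ω : ι → ℤ) (c : Fin d → ι → ℂ) (g : Fin d → UnitAddCircle → ℝ)
    (l : Fin d → ℝ) (B R : ℝ) (hB : 0 ≤ B)
    (hx : ∀ k : Fin d → ℤ, k ≠ 0 → (∀ i, ∃ p ∈ S, k i = ω p) →
      ‖∑ n ∈ Finset.range N, unitExp (∑ i, k i • x n i)‖ ≤ N * B)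
    (hg : ∀ i t, (g i t : ℂ) = ∑ p ∈ S, c i p * unitExp (ω p • t))
    (hl : ∀ i, ∑ p ∈ S, (if ω p = 0 then c i p else 0) = l i)
    (hR : ∀ i, ∑ p ∈ S, ‖c i p‖ ≤ R) :
    |∑ n ∈ Finset.range N, ∏ i, g i (x n i) - N * ∏ i, l i| ≤ N * (R ^ d * B) := by
  have e1 : ((∑ n ∈ Finset.range N, ∏ i, g i (x n i) : ℝ) : ℂ)
      = ∑ p ∈ Fintype.piFinset fun _ : Fin d => S, (∏ i, c i (p i)) *
          ∑ n ∈ Finset.range N, unitExp (∑ i, ω (p i) • x n i) := by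
    push_cast
    simp_rw [hg, Finset.prod_univ_sum, Finset.mul_sum]
    rw [Finset.sum_comm]
    refine Finset.sum_congr rfl fun p _ => Finset.sum_congr rfl fun n _ => ?_
    rw [unitExp_sum, Finset.prod_mul_distrib]
  have e2 : ((∏ i, l i : ℝ) : ℂ) = ∑ p ∈ Fintype.piFinset fun _ : Fin d => S,
      (if ∀ i, ω (p i) = 0 then ∏ i, c i (p i) else 0) := by
    push_cast
    simp_rw [← hl, Finset.prod_univ_sum, Finset.prod_ite_zero]
    simp
  rw [← Real.norm_eq_abs, ← Complex.norm_real]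
  push_cast at e1 e2 ⊢
  rw [e1, e2, Finset.mul_sum, ← Finset.sum_sub_distrib]
  -- Tuples with all frequencies zero cancel exactly against the main term; all others are covered
  -- by `hx`.
  have hterm : ∀ p ∈ Fintype.piFinset fun _ : Fin d => S,
      ‖(∏ i, c i (p i)) * ∑ n ∈ Finset.range N, unitExp (∑ i, ω (p i) • x n i)
        - N * (if ∀ i, ω (p i) = 0 then ∏ i, c i (p i) else 0)‖
      ≤ (∏ i, ‖c i (p i)‖) * (N * B) := by
    intro p hp
    split_ifs with h0
    · simp only [h0, zero_smul, Finset.sum_const_zero, unitExp_zero, Finset.sum_const,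
        Finset.card_range, nsmul_eq_mul, mul_one]
      rw [mul_comm, sub_self, norm_zero]
      positivity
    · rw [mul_zero, sub_zero, norm_mul, norm_prod]
      gcongr
      refine hx (fun i => ω (p i)) (fun h => h0 fun i => congrFun h i) fun i =>
        ⟨p i, Fintype.mem_piFinset.1 hp i, rfl⟩
  refine (norm_sum_le_of_le _ hterm).trans ?_
  rw [← Finset.sum_mul, ← Finset.prod_univ_sum (fun _ : Fin d => S) (fun i p => ‖c i p‖)]
  have : ∏ i, ∑ p ∈ S, ‖c i p‖ ≤ R ^ d := by
    simpa using Finset.prod_le_prod (s := Finset.univ)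
      (fun i _ => Finset.sum_nonneg fun p _ => norm_nonneg (c i p)) (fun i _ => hR i)
  calc _ ≤ R ^ d * (N * B) := by gcongr
    _ = _ := by ring

/-- Length up to `2` is allowed because an enlarged interval may exceed a full period. The factor `2
* K` bounds the sum of `K ^ 2` coefficients of size at most `2 / K`. -/
lemma abs_sum_prod_fejerSmooth_sub_le {d : ℕ} (x : ℕ → UnitAddTorus (Fin d)) (N K : ℕ)
    (hK : 0 < K) (a b : Fin d → ℝ) (hab : ∀ i, a i ≤ b i) (hb : ∀ i, b i ≤ a i + 2) (B : ℝ)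
    (hB : 0 ≤ B)
    (hx : ∀ k : Fin d → ℤ, k ≠ 0 → (∀ i, |k i| ≤ K) →
      ‖∑ n ∈ Finset.range N, unitExp (∑ i, k i • x n i)‖ ≤ N * B) :
    |∑ n ∈ Finset.range N, ∏ i, fejerSmooth K (a i) (b i) (x n i) - N * ∏ i, (b i - a i)|
      ≤ N * ((2 * K) ^ d * B) := by
  have hKr : (K : ℝ) ≠ 0 := by positivity
  refine abs_sum_prod_sub_le x N (Finset.range K ×ˢ Finset.range K) (fun p => (p.1 : ℤ) - p.2)
    (fun i => fejerCoeff K (a i) (b i)) (fun i => fejerSmooth K (a i) (b i)) (fun i => b i - a i)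
    B (2 * K) hB ?_ (fun i t => fejerSmooth_eq_sum K (a i) (b i) t) ?_ ?_
  · intro k hk hkS
    refine hx k hk fun i => ?_
    obtain ⟨p, hp, hkp⟩ := hkS i
    rw [Finset.mem_product, Finset.mem_range, Finset.mem_range] at hp
    rw [hkp, abs_le]
    omega
  · intro i
    rw [← sum_diag_const K hK (b i - a i), Complex.ofReal_sum]
    refine Finset.sum_congr rfl fun p _ => ?_
    by_cases hp : p.1 = p.2
    · rw [if_pos (by simp [hp]), if_pos hp, fejerCoeff_diag _ _ _ _ hp]
    · rw [if_neg (sub_ne_zero.2 (by exact_mod_cast hp)), if_neg hp, Complex.ofReal_zero]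
  · intro i
    refine (Finset.sum_le_sum fun p _ => norm_fejerCoeff_le K _ _ (hab i) p).trans ?_
    rw [Finset.sum_const, Finset.card_product, Finset.card_range, nsmul_eq_mul]
    push_cast
    calc (K : ℝ) * K * ((b i - a i) / K) = K * (b i - a i) := by field_simp
      _ ≤ K * 2 := by gcongr; linarith [hb i]
      _ = _ := mul_comm _ _

/-- Multiplying out gives `2 ^ s.card - 1` terms besides the main one, each at most `x`. -/
lemma prod_add_le {ι : Type*} (s : Finset ι) (a : ι → ℝ) (x : ℝ) (hx0 : 0 ≤ x) (hx1 : x ≤ 1)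
    (ha0 : ∀ i ∈ s, 0 ≤ a i) (ha1 : ∀ i ∈ s, a i ≤ 1) :
    ∏ i ∈ s, (a i + x) ≤ ∏ i ∈ s, a i + (2 ^ s.card - 1) * x := by
  classical
  induction s using Finset.induction_on with
  | empty => simp
  | insert j s hj ih =>
    have ih' := ih (fun i hi => ha0 i (Finset.mem_insert_of_mem hi))
      (fun i hi => ha1 i (Finset.mem_insert_of_mem hi))
    have h0 := ha0 j (Finset.mem_insert_self _ _)
    have h1 := ha1 j (Finset.mem_insert_self _ _)
    have hP : ∏ i ∈ s, a i ≤ 1 := Finset.prod_le_one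
      (fun i hi => ha0 i (Finset.mem_insert_of_mem hi))
      (fun i hi => ha1 i (Finset.mem_insert_of_mem hi))
    have hpow : (1 : ℝ) ≤ 2 ^ s.card := one_le_pow₀ (by norm_num)
    rw [Finset.prod_insert hj, Finset.prod_insert hj, Finset.card_insert_of_notMem hj, pow_succ]
    have h2 : (a j + x) * ∏ i ∈ s, (a i + x)
        ≤ (a j + x) * (∏ i ∈ s, a i + (2 ^ s.card - 1) * x) := by gcongr
    have h3 : x * ∏ i ∈ s, a i ≤ x * 1 := by gcongr
    have h4 : (a j + x) * ((2 ^ s.card - 1) * x) ≤ 2 * ((2 ^ s.card - 1) * x) := by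
      have : 0 ≤ (2 ^ s.card - 1) * x := mul_nonneg (by linarith) hx0
      gcongr
      linarith
    linarith

lemma circleRep_mem (t : UnitAddCircle) : 0 ≤ circleRep t ∧ circleRep t < 1 := by
  have h := (AddCircle.equivIco (1 : ℝ) 0 t).2
  exact ⟨h.1, h.2.trans_eq (zero_add 1)⟩

lemma coe_circleRep (t : UnitAddCircle) : ((circleRep t : ℝ) : UnitAddCircle) = t :=
  AddCircle.coe_equivIco (p := (1 : ℝ)) (a := 0)

lemma countIn_eq_sum_range {d N : ℕ} (C : Set (UnitAddTorus (Fin d)))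
    (x : ℕ → UnitAddTorus (Fin d)) :
    countIn C (fun n : Fin N => x n)
      = ∑ n ∈ Finset.range N, C.indicator (fun _ => (1 : ℝ)) (x n) :=
  Fin.sum_univ_eq_sum_range (fun n => C.indicator (fun _ => (1 : ℝ)) (x n)) N

lemma volume_circleRep_preimage (β κ : ℝ) (hβ : 0 ≤ β) (hκ : κ ≤ 1) :
    volume (circleRep ⁻¹' Set.Ico β κ) = ENNReal.ofReal (κ - β) := by
  have hmeas : Measurable circleRep :=
    measurable_subtype_coe.comp (AddCircle.measurableEquivIco (1 : ℝ) 0).measurable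
  -- The fundamental domain here is half-open on the left, whereas `circleRep` takes values in `[0,
  -- 1)`; the two differ by a null set.
  rw [AddCircle.add_projection_respects_measure (T := (1 : ℝ)) 0 (hmeas measurableSet_Ico),
    measure_congr ((Filter.EventuallyEq.refl _ _).inter
      (Ico_ae_eq_Ioc (μ := (volume : Measure ℝ)) (a := 0) (b := 0 + 1)).symm),
    ← Real.volume_Ico]
  congr 1
  ext r
  have key : ∀ r : ℝ, r ∈ Set.Ico (0 : ℝ) (0 + 1) → circleRep (r : UnitAddCircle) = r :=
    fun r hr => congrArg Subtype.val (AddCircle.equivIco_coe_eq (p := (1 : ℝ)) hr)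
  constructor
  · rintro ⟨h1, h2⟩
    have h1' : circleRep (r : UnitAddCircle) ∈ Set.Ico β κ := h1
    rwa [key r h2] at h1'
  · intro h
    have h2 : r ∈ Set.Ico (0 : ℝ) (0 + 1) := ⟨hβ.trans h.1, by linarith [h.2]⟩
    refine ⟨?_, h2⟩
    change circleRep (r : UnitAddCircle) ∈ Set.Ico β κ
    rwa [key r h2]

lemma volume_real_torusBox {d : ℕ} (β κ : Fin d → ℝ)
    (h : ∀ i, 0 ≤ β i ∧ β i < κ i ∧ κ i ≤ 1) :
    volume.real (torusBox β κ) = ∏ i, (κ i - β i) := by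
  have e : torusBox β κ = Set.pi Set.univ fun i => circleRep ⁻¹' Set.Ico (β i) (κ i) := by
    ext θ
    simp [torusBox]
  rw [Measure.real, e, volume_pi_pi, ENNReal.toReal_prod]
  refine Finset.prod_congr rfl fun i _ => ?_
  rw [volume_circleRep_preimage _ _ (h i).1 (h i).2.2,
    ENNReal.toReal_ofReal (by linarith [(h i).2.1])]

section Box

variable {d : ℕ} (x : ℕ → UnitAddTorus (Fin d)) (N M : ℕ) (hM : 2 ≤ M) (B : ℝ) (hB : 0 ≤ B)
  (hx : ∀ k : Fin d → ℤ, k ≠ 0 → (∀ i, |k i| ≤ (M ^ 3 : ℕ)) →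
      ‖∑ n ∈ Finset.range N, unitExp (∑ i, k i • x n i)‖ ≤ N * B)
  (β κ : Fin d → ℝ) (h : ∀ i, 0 ≤ β i ∧ β i < κ i ∧ κ i ≤ 1)

include hM hB hx h

/-- The majorant is the smoothed box enlarged by `ε = 1 / M` on each side. Fejér order `M ^ 3` makes
the kernel tail `ε / 4`, and Bernoulli's inequality handles the product of the `d` factors. -/
lemma countIn_torusBox_le :
    countIn (torusBox β κ) (fun n : Fin N => x n)
      ≤ N * (∏ i, (κ i - β i) + (2 ^ (d + 1) + d + 1) / M + (2 * (M : ℝ) ^ 3) ^ d * B) := by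
  have hMr : (2 : ℝ) ≤ M := by exact_mod_cast hM
  have hM0 : (0 : ℝ) < M := by linarith
  set ε : ℝ := 1 / M with hε
  have hε0 : 0 < ε := by positivity
  have hε1 : ε ≤ 1 / 2 := one_div_le_one_div_of_le (by norm_num) hMr
  have hη : 1 / (4 * ((M ^ 3 : ℕ) : ℝ) * ε ^ 2) = ε / 4 := by
    rw [hε]; push_cast; field_simp
  have hmean := (abs_le.1 (abs_sum_prod_fejerSmooth_sub_le x N (M ^ 3) (by positivity)
    (fun i => β i - ε) (fun i => κ i + ε) (fun i => by linarith [(h i).2.1])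
    (fun i => by linarith [(h i).1, (h i).2.2]) B hB hx)).2
  have hpt : ∀ θ, (torusBox β κ).indicator (fun _ => (1 : ℝ)) θ
      ≤ ∏ i, fejerSmooth (M ^ 3) (β i - ε) (κ i + ε) (θ i) + d * (ε / 4) := by
    intro θ
    have hnn : ∀ i, 0 ≤ fejerSmooth (M ^ 3) (β i - ε) (κ i + ε) (θ i) := fun i =>
      fejerSmooth_nonneg _ _ _ (by linarith [(h i).2.1]) _
    by_cases hθ : θ ∈ torusBox β κ
    · rw [Set.indicator_of_mem hθ]
      have hge : ∀ i, 1 - ε / 4 ≤ fejerSmooth (M ^ 3) (β i - ε) (κ i + ε) (θ i) := by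
        intro i
        have := one_sub_le_fejerSmooth (M ^ 3) (by positivity) (β i - ε) (κ i + ε)
          (circleRep (θ i)) ε hε0 hε1 (by linarith [(hθ i).1]) (by linarith [(hθ i).2])
        rwa [hη, coe_circleRep] at this
      have hpow : (1 - ε / 4) ^ d ≤ ∏ i, fejerSmooth (M ^ 3) (β i - ε) (κ i + ε) (θ i) := by
        simpa using Finset.prod_le_prod (s := Finset.univ)
          (f := fun _ : Fin d => 1 - ε / 4) (fun i _ => by linarith) (fun i _ => hge i)
      have hbern := one_add_mul_le_pow (a := -(ε / 4)) (by linarith) d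
      rw [← sub_eq_add_neg] at hbern
      linarith
    · rw [Set.indicator_of_notMem hθ]
      have := Finset.prod_nonneg (s := Finset.univ) fun i _ => hnn i
      positivity
  have hprod := prod_add_le Finset.univ (fun i => κ i - β i) (2 * ε) (by positivity) (by linarith)
    (fun i _ => by linarith [(h i).2.1]) (fun i _ => by linarith [(h i).1, (h i).2.2])
  rw [Finset.card_univ, Fintype.card_fin] at hprod
  have hprod' : ∏ i, (κ i + ε - (β i - ε)) ≤ ∏ i, (κ i - β i) + (2 ^ d - 1) * (2 * ε) := by
    convert hprod using 3
    ring
  have hsum : countIn (torusBox β κ) (fun n : Fin N => x n)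
      ≤ ∑ n ∈ Finset.range N, ∏ i, fejerSmooth (M ^ 3) (β i - ε) (κ i + ε) (x n i)
        + N * (d * (ε / 4)) := by
    rw [countIn_eq_sum_range]
    refine (Finset.sum_le_sum fun n _ => hpt (x n)).trans ?_
    simp [Finset.sum_add_distrib]
  have hfin : ∏ i, (κ i + ε - (β i - ε)) + d * (ε / 4)
      ≤ ∏ i, (κ i - β i) + (2 ^ (d + 1) + d + 1) / M := by
    have e : (2 ^ (d + 1) + d + 1) / (M : ℝ) = (2 ^ d - 1) * (2 * ε) + d * ε + 3 * ε := by
      rw [hε, pow_succ]; ring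
    have : 0 ≤ d * ε := by positivity
    rw [e]
    linarith
  have := mul_le_mul_of_nonneg_left hfin (Nat.cast_nonneg (α := ℝ) N)
  push_cast at hmean
  linarith

/-- The minorant is the smoothed box shrunk by `ε = 1 / M`: outside the original box some factor is
at most `ε / 4` and the others are at most `1`. -/
lemma le_countIn_torusBox :
    N * (∏ i, (κ i - β i) - (2 ^ (d + 1) + d + 1) / M - (2 * (M : ℝ) ^ 3) ^ d * B)
      ≤ countIn (torusBox β κ) (fun n : Fin N => x n) := by
  have hMr : (2 : ℝ) ≤ M := by exact_mod_cast hM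
  have hM0 : (0 : ℝ) < M := by linarith
  set ε : ℝ := 1 / M with hε
  have hε0 : 0 < ε := by positivity
  have hε1 : ε ≤ 1 / 2 := one_div_le_one_div_of_le (by norm_num) hMr
  have hη : 1 / (4 * ((M ^ 3 : ℕ) : ℝ) * ε ^ 2) = ε / 4 := by
    rw [hε]; push_cast; field_simp
  have hpow1 : (1 : ℝ) ≤ 2 ^ d := one_le_pow₀ (by norm_num)
  have e : (2 ^ (d + 1) + d + 1) / (M : ℝ) = (2 ^ d - 1) * (2 * ε) + d * ε + 3 * ε := by
    rw [hε, pow_succ]; ring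
  have hdε : 0 ≤ d * ε := by positivity
  have h2ε : 0 ≤ (2 ^ d - 1) * (2 * ε) := mul_nonneg (by linarith) (by linarith)
  have hcount : 0 ≤ countIn (torusBox β κ) (fun n : Fin N => x n) :=
    Finset.sum_nonneg fun n _ => Set.indicator_nonneg (fun _ _ => zero_le_one) _
  -- A side shorter than `2 * ε` cannot be shrunk, but then the volume is below `2 * ε` and the
  -- claimed lower bound is nonpositive.
  by_cases hsmall : ∃ i, κ i - β i < 2 * ε
  · obtain ⟨i, hi⟩ := hsmall
    refine le_trans (mul_nonpos_of_nonneg_of_nonpos (Nat.cast_nonneg N) ?_) hcount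
    have hle : ∏ j, (κ j - β j) ≤ κ i - β i := by
      rw [← Finset.mul_prod_erase _ _ (Finset.mem_univ i)]
      refine mul_le_of_le_one_right (by linarith [(h i).2.1]) (Finset.prod_le_one ?_ ?_)
      · intro j _; linarith [(h j).2.1]
      · intro j _; linarith [(h j).1, (h j).2.2]
    have : 0 ≤ (2 * (M : ℝ) ^ 3) ^ d * B := by positivity
    rw [e]
    linarith
  push Not at hsmall
  have hmean := (abs_le.1 (abs_sum_prod_fejerSmooth_sub_le x N (M ^ 3) (by positivity)
    (fun i => β i + ε) (fun i => κ i - ε) (fun i => by linarith [hsmall i])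
    (fun i => by linarith [(h i).1, (h i).2.2]) B hB hx)).1
  have hpt : ∀ θ, ∏ i, fejerSmooth (M ^ 3) (β i + ε) (κ i - ε) (θ i) - ε / 4
      ≤ (torusBox β κ).indicator (fun _ => (1 : ℝ)) θ := by
    intro θ
    have hnn : ∀ i, 0 ≤ fejerSmooth (M ^ 3) (β i + ε) (κ i - ε) (θ i) := fun i =>
      fejerSmooth_nonneg _ _ _ (by linarith [hsmall i]) _
    have hle1 : ∀ i, fejerSmooth (M ^ 3) (β i + ε) (κ i - ε) (θ i) ≤ 1 := fun i =>
      fejerSmooth_le_one _ (by positivity) _ _ (by linarith [hsmall i])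
        (by linarith [(h i).1, (h i).2.2]) _
    by_cases hθ : θ ∈ torusBox β κ
    · rw [Set.indicator_of_mem hθ]
      have := Finset.prod_le_one (s := Finset.univ) (fun i _ => hnn i) (fun i _ => hle1 i)
      linarith
    · rw [Set.indicator_of_notMem hθ]
      obtain ⟨i, hi⟩ : ∃ i, ¬ (β i ≤ circleRep (θ i) ∧ circleRep (θ i) < κ i) := by
        by_contra hcon
        push Not at hcon
        exact hθ hcon
      have hfar := fejerSmooth_le_of_far (M ^ 3) (β i + ε) (κ i - ε) (circleRep (θ i)) ε hε0
        (by linarith [hsmall i]) (by linarith [(h i).1, (h i).2.2]) (by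
          intro s hs
          have hs1 := hs.1
          have hs2 := hs.2
          have hr := circleRep_mem (θ i)
          have hi' := h i
          refine ⟨?_, ?_⟩
          · rcases lt_or_ge (circleRep (θ i)) (β i) with hlt | hge
            · rw [abs_of_nonpos (by linarith)]
              linarith
            · have : κ i ≤ circleRep (θ i) := by
                by_contra hcon
                exact hi ⟨hge, not_le.1 hcon⟩
              rw [abs_of_nonneg (by linarith)]
              linarith
          · rw [abs_le]
            constructor <;> linarith)
      rw [hη, coe_circleRep] at hfar
      have : ∏ j, fejerSmooth (M ^ 3) (β j + ε) (κ j - ε) (θ j)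
          ≤ fejerSmooth (M ^ 3) (β i + ε) (κ i - ε) (θ i) := by
        rw [← Finset.mul_prod_erase _ _ (Finset.mem_univ i)]
        exact mul_le_of_le_one_right (hnn i)
          (Finset.prod_le_one (fun j _ => hnn j) (fun j _ => hle1 j))
      linarith
  have hprod := prod_add_le Finset.univ (fun i => κ i - ε - (β i + ε)) (2 * ε) (by positivity)
    (by linarith) (fun i _ => by linarith [hsmall i])
    (fun i _ => by linarith [(h i).1, (h i).2.2])
  rw [Finset.card_univ, Fintype.card_fin] at hprod
  have hprod' : ∏ i, (κ i - β i) ≤ ∏ i, (κ i - ε - (β i + ε)) + (2 ^ d - 1) * (2 * ε) := by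
    convert hprod using 3
    ring
  have hsum : ∑ n ∈ Finset.range N, ∏ i, fejerSmooth (M ^ 3) (β i + ε) (κ i - ε) (x n i)
      - N * (ε / 4) ≤ countIn (torusBox β κ) (fun n : Fin N => x n) := by
    rw [countIn_eq_sum_range]
    refine le_trans ?_ (Finset.sum_le_sum fun n _ => hpt (x n))
    simp [Finset.sum_sub_distrib]
  have hfin : ∏ i, (κ i - β i) - (2 ^ (d + 1) + d + 1) / M
      ≤ ∏ i, (κ i - ε - (β i + ε)) - ε / 4 := by
    rw [e]
    linarith
  have := mul_le_mul_of_nonneg_left hfin (Nat.cast_nonneg (α := ℝ) N)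
  push_cast at hmean
  linarith

end Box

/-- A weak form of the Erdős–Turán–Koksma inequality. -/
theorem discrepancy_le {d : ℕ} (x : ℕ → UnitAddTorus (Fin d)) (N M : ℕ) (hN : 0 < N) (hM : 2 ≤ M)
    (B : ℝ) (hB : 0 ≤ B)
    (hx : ∀ k : Fin d → ℤ, k ≠ 0 → (∀ i, |k i| ≤ (M ^ 3 : ℕ)) →
      ‖∑ n ∈ Finset.range N, unitExp (∑ i, k i • x n i)‖ ≤ N * B) :
    discrepancy (fun n : Fin N => x n)
      ≤ (2 ^ (d + 1) + d + 1) / M + (2 * (M : ℝ) ^ 3) ^ d * B := by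
  have hNr : (0 : ℝ) < N := by exact_mod_cast hN
  refine Real.sSup_le ?_ (by positivity)
  rintro r ⟨C, ⟨β, κ, h, rfl⟩, rfl⟩
  rw [volume_real_torusBox β κ h, abs_le]
  have h1 := countIn_torusBox_le x N M hM B hB hx β κ h
  have h2 := le_countIn_torusBox x N M hM B hB hx β κ h
  rw [← le_div_iff₀' hNr] at h2
  rw [← div_le_iff₀' hNr] at h1
  constructor <;> linarith

/-! ### Orbits of the skew-shift -/

lemma fwdDiff_iter_skewShift {d : ℕ} (α : UnitAddCircle) (y : UnitAddTorus (Fin d)) (j : ℕ)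
    (hj : j < d) :
    (fwdDiff 1)^[j + 1] (fun n : ℕ => (skewShift d α)^[n] y ⟨j, hj⟩) = fun _ => α := by
  have hstep : ∀ (i : ℕ) (hi : i < d),
      fwdDiff 1 (fun n : ℕ => (skewShift d α)^[n] y ⟨i, hi⟩)
        = fun n => if i = 0 then α else (skewShift d α)^[n] y ⟨i - 1, by omega⟩ := by
    intro i hi
    ext n
    simp only [fwdDiff, Function.iterate_succ_apply', skewShift]
    abel
  induction j with
  | zero => simpa using hstep 0 hj
  | succ j ih =>
    rw [Function.iterate_succ_apply, hstep]
    simpa using ih (by omega) hstep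

lemma exists_fwdDiff_iter_character {d : ℕ} (α : UnitAddCircle) (y : UnitAddTorus (Fin d))
    (k : Fin d → ℤ) (hk : k ≠ 0) :
    ∃ r : Fin d, k r ≠ 0 ∧
      (fwdDiff 1)^[(r : ℕ) + 1] (fun n : ℕ => ∑ i, k i • (skewShift d α)^[n] y i)
        = fun _ => k r • α := by
  obtain ⟨r, hr, hmax⟩ := Finset.exists_max_image (Finset.univ.filter fun i => k i ≠ 0) id (by
    obtain ⟨i, hi⟩ := Function.ne_iff.1 hk
    exact ⟨i, by simpa using hi⟩)
  refine ⟨r, (Finset.mem_filter.1 hr).2, ?_⟩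
  have e : (fun n : ℕ => ∑ i, k i • (skewShift d α)^[n] y i)
      = ∑ i, k i • fun n : ℕ => (skewShift d α)^[n] y i := by
    ext n
    simp
  rw [e, fwdDiff_iter_finsetSum, Finset.sum_eq_single r]
  · rw [fwdDiff_iter_const_smul, fwdDiff_iter_skewShift]
    rfl
  · intro i _ hir
    rw [fwdDiff_iter_const_smul]
    rcases lt_or_gt_of_ne hir with hlt | hgt
    · obtain ⟨m, hm⟩ := Nat.exists_eq_add_of_lt (Fin.lt_def.1 hlt)
      have hm' : (r : ℕ) + 1 = (m + 1) + ((i : ℕ) + 1) := by omega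
      rw [hm', Function.iterate_add_apply, fwdDiff_iter_skewShift, Function.iterate_succ_apply,
        fwdDiff_const]
      have hz : (fwdDiff 1)^[m] (fun _ : ℕ => (0 : UnitAddCircle)) = fun _ => 0 :=
        Function.iterate_fixed (fwdDiff_const 1 (0 : UnitAddCircle)) m
      rw [hz]
      ext n
      simp
    · have : k i = 0 := by
        by_contra hne
        exact absurd (hmax i (by simp [hne])) (not_le.2 hgt)
      rw [this, zero_smul]
  · simp

/-- Since `|k| ≥ 1`, raising the exponent weakens the condition; `weyl_sum_bound` needs a natural
one. -/
lemma diophantineWith_natCeil {c τ : ℝ} (hc : 0 < c) {α : UnitAddCircle}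
    (hα : α ∈ DiophantineWith c τ) : α ∈ DiophantineWith c (⌈τ⌉₊ : ℝ) := by
  intro k hk
  refine le_trans ?_ (hα k hk)
  have h1 : (1 : ℝ) ≤ |(k : ℝ)| := by exact_mod_cast Int.one_le_abs hk
  have h2 : |(k : ℝ)| ^ τ ≤ |(k : ℝ)| ^ (⌈τ⌉₊ : ℝ) :=
    Real.rpow_le_rpow_of_exponent_le h1 (Nat.le_ceil τ)
  have h3 : 0 < |(k : ℝ)| ^ τ := Real.rpow_pos_of_pos (by linarith) _
  gcongr

lemma discrepancy_skewShift_le (d : ℕ) (τ : ℝ) : ∃ A : ℕ, 1 ≤ A ∧ ∀ α ∈ Diophantine τ,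
    ∃ E : ℝ, 0 ≤ E ∧ ∀ M N : ℕ, 2 ≤ M → M ^ A ≤ N → ∀ y : UnitAddTorus (Fin d),
      discrepancy (fun n : Fin N => (skewShift d α)^[(n : ℕ)] y) ≤ E / M := by
  -- Frequencies reach `M ^ 3`, hence `v = 3`. The saving `3 * d + 1` beats the coefficient loss `(2
  -- * M ^ 3) ^ d` by one factor `M`.
  choose A hA using fun D => weyl_sum_bound ⌈τ⌉₊ D (3 * d + 1) 3
  refine ⟨1 + ∑ D ∈ Finset.range d, A D, by omega, ?_⟩
  rintro α ⟨c, hc, hα⟩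
  choose C hC0 hC using fun D => hA D α c hc (diophantineWith_natCeil hc hα)
  set C' := ∑ D ∈ Finset.range d, C D with hC'
  have hC'0 : 0 ≤ C' := Finset.sum_nonneg fun D _ => hC0 D
  refine ⟨2 ^ (d + 1) + d + 1 + 2 ^ d * C', by positivity, fun M N hM hN y => ?_⟩
  have hM0 : (0 : ℝ) < M := by positivity
  have hNpos : 0 < N := lt_of_lt_of_le (by positivity) hN
  refine (discrepancy_le (fun n => (skewShift d α)^[n] y) N M hNpos hM (C' / M ^ (3 * d + 1))
    (by positivity) ?_).trans (le_of_eq ?_)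
  · intro k hk hkM
    obtain ⟨r, hr, hφ⟩ := exists_fwdDiff_iter_character α y k hk
    have hrd : (r : ℕ) ∈ Finset.range d := Finset.mem_range.2 r.2
    have hAr : M ^ A r ≤ N := by
      refine (Nat.pow_le_pow_right (by omega) ?_).trans hN
      have := Finset.single_le_sum (f := A) (fun D _ => Nat.zero_le _) hrd
      omega
    refine (hC r M N (by omega) hAr (k r) _ hr (by exact_mod_cast hkM r) hφ).trans ?_
    have := Finset.single_le_sum (f := C) (fun D _ => hC0 D) hrd
    gcongr
  · rw [mul_pow, ← pow_mul, pow_succ, add_div _ _ (M : ℝ)]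
    field_simp
    ring

lemma hasStronglyBoundedDiscrepancy_skewShift (d : ℕ) (τ : ℝ) : ∃ δ : ℝ, 0 < δ ∧
    ∀ α ∈ Diophantine τ, HasStronglyBoundedDiscrepancy δ (skewShift d α) := by
  obtain ⟨A, hA1, hA⟩ := discrepancy_skewShift_le d τ
  have hAr : (0 : ℝ) < A := by exact_mod_cast hA1
  -- Taking `M` near `N ^ (1 / A)` gives a bound of order `E * N ^ (-1 / A)`; half of the exponent
  -- is given up to absorb `E`, which depends on `α`.
  refine ⟨1 / (2 * A), by positivity, fun α hα => ?_⟩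
  obtain ⟨E, hE0, hE⟩ := hA α hα
  set δ : ℝ := 1 / (2 * A) with hδ
  have hδ0 : 0 < δ := by positivity
  obtain ⟨N₀, hN₀⟩ := Filter.eventually_atTop.1
    (((tendsto_rpow_atTop hδ0).comp tendsto_natCast_atTop_atTop).eventually_ge_atTop (2 * E + 2))
  refine ⟨N₀, fun N hN θ => ?_⟩
  set a : ℝ := (N : ℝ) ^ δ with ha
  have haE : 2 * E + 2 ≤ a := hN₀ N hN.le
  have hN0 : (0 : ℝ) ≤ N := Nat.cast_nonneg N
  have ha2 : a ^ 2 = (N : ℝ) ^ (1 / A : ℝ) := by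
    rw [ha, ← Real.rpow_natCast, ← Real.rpow_mul hN0]
    congr 1
    rw [hδ]; push_cast; field_simp
  have haN : (a ^ 2) ^ A = N := by
    rw [ha2, one_div, Real.rpow_inv_natCast_pow hN0 (by omega)]
  set M := ⌊a ^ 2⌋₊ with hM
  have hMle : (M : ℝ) ≤ a ^ 2 := Nat.floor_le (by positivity)
  have hMlt : a ^ 2 < M + 1 := Nat.lt_floor_add_one _
  have ha22 : 2 ≤ a ^ 2 := by nlinarith
  have hM2 : 2 ≤ M := Nat.le_floor (by exact_mod_cast ha22)
  have hMN : M ^ A ≤ N := by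
    have : (M : ℝ) ^ A ≤ N := haN ▸ pow_le_pow_left₀ (Nat.cast_nonneg _) hMle A
    exact_mod_cast this
  refine (hE M N hM2 hMN θ).trans ?_
  have hM0 : (0 : ℝ) < M := by positivity
  have ha0 : 0 < a := by linarith
  rw [Real.rpow_neg hN0, ← ha, inv_eq_one_div, div_le_div_iff₀ hM0 ha0]
  nlinarith

theorem lemma3p5 (d : ℕ) (hd : 1 ≤ d) (τ : ℝ) :
    ∃ δ : ℝ, 0 < δ ∧ ∀ α : UnitAddCircle, α ∈ Diophantine τ →
      (∃ N₀ : ℕ, ∀ N : ℕ, N₀ < N → ∀ y : UnitAddTorus (Fin d),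
        discrepancy (fun n : Fin N => (skewShift d α)^[(n : ℕ) + 1] y) ≤ (N : ℝ) ^ (-δ)) ∧
      HasStronglyBoundedDiscrepancy δ (skewShift d α) := by
  obtain ⟨δ, hδ, h⟩ := hasStronglyBoundedDiscrepancy_skewShift d τ
  refine ⟨δ, hδ, fun α hα => ⟨?_, h α hα⟩⟩
  obtain ⟨N₀, hN₀⟩ := h α hα
  refine ⟨N₀, fun N hN y => ?_⟩
  -- The orbit segment from time `1` to `N` is the segment from `0` to `N - 1` of the image point,
  -- and the bound is uniform in the starting point.
  simpa only [Function.iterate_succ_apply] using hN₀ N hN (skewShift d α y)
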